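/- Let $n\ge 1$, let $\Delta^{n+1}=\{\lambda\in\mathbb{R}^{n+1}_{+}:\sum_{j=1}^{n+1}\lambda_j=1\}$, and let $\mathcal{P}=(P^i)_{i=1}^n$ be the SOS2 constraint on $\Delta^{n+1}$, i.e. $P^i=\{\lambda\in\Delta^{n+1}:\lambda_j\le 0\ \ \forall j\notin\{i,i+1\}\}$. For pairwise distinct $h^1,\dots,h^n\in\{0,1\}^k$ and $H=(h^i)_{i=1}^n$ put $$Q(\mathcal{P},H)=\operatorname{conv}\Bigl(\bigcup_{i=1}^n P^i\times\{h^i\}\Bigr)\subseteq\mathbb{R}^{n+1}\times\mathbb{R}^k .$$ *Sizes.* The size of a polyhedron $Q$, $\operatorname{size}(Q)$, is the minimum of $2e+m$ over all descriptions of $Q$ by $e$ linear equations and $m$ linear inequalities, each of the $m$ inequalities being strict at some point of $Q$ (so equations count as two inequalities, and whatever holds with equality on all of $Q$ has to be written as an equation). Let $h^0=h^1$, $h^{n+1}=h^n$, $c^i=h^{i+1}-h^i$ for $1\le i\le n-1$, let $L(H)=\operatorname{aff}(H)-h^1$, and $M(b)=\{y\in L(H): b\cdot y=0\}$ for $b\in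 L(H)\setminus\{0\}$. Choose $b^1,\dots,b^L\in L(H)\setminus\{0\}$, one for each linear hyperplane of $L(H)$ spanned by a subset of $\{c^1,\dots,c^{n-1}\}$, such that $M(b^1),\dots,M(b^L)$ are exactly these hyperplanes. Then $\operatorname{size}_G(Q(\mathcal{P},H))$ is the number of the general inequalities $$\sum_{j=1}^{n+1}\min\{b^l\cdot h^j,b^l\cdot h^{j-1}\}\lambda_j\le b^l\cdot y\le\sum_{j=1}^{n+1}\max\{b^l\cdot h^j,b^l\cdot h^{j-1}\}\lambda_j,\qquad l=1,\dots,L$$ (inequalities with the same solution set counted once), and $\operatorname{size}_B(Q(\mathcal{P},H))$ is the number of the variable bounds $\lambda_j\ge 0$, $j\in J$, where $$J=\{1,n+1\}\cup\bigl\{j\in\{2,\dots,n\}: L(H)=\operatorname{span}\{c^i: 1\le i\le n-1,\ i\ne j-1\}\bigr\}.$$ *Result.* Let $H$ be the unary encoding, i.e. $k=n$ and $h^i=\mathbf{e}^i$ is the $i$-th unit vector. Then for all $\lambda\in\mathbb{R}^{n+1}$ and $y\in\mathbb{R}^n$, $(\lambda,y)\in Q(\mathcal{P},H)$ if and only if $$\sum_{j=1}^{n+1}\lambda_j=1,\qquad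 \sum_{i=1}^n y_i=1,\tag{1}$$ $$\sum_{j=l+2}^{n+1}\lambda_j\le\sum_{i=l+1}^n y_i,\qquad \sum_{j=1}^{l}\lambda_j\le\sum_{i=1}^l y_i\qquad\text{for all } l\in\{1,\dots,n-1\},\tag{2}$$ $$\lambda_1\ge 0,\qquad \lambda_{n+1}\ge 0.\tag{3}$$ Furthermore, each inequality in (2) and (3) is facet defining for $Q(\mathcal{P},H)$ (it is valid for $Q(\mathcal{P},H)$ and the face on which it holds with equality is nonempty and of dimension $\dim Q(\mathcal{P},H)-1$), and $$\operatorname{size}(Q(\mathcal{P},H))=2n+4,\qquad \operatorname{size}_G(Q(\mathcal{P},H))=2(n-1),\qquad \operatorname{size}_B(Q(\mathcal{P},H))=2 .$$ -/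

import Mathlib

open scoped Matrix

/-! ### Polyhedral notions in a finite-dimensional real vector space -/

section Polyhedra

variable {E : Type*} [AddCommGroup E] [Module ℝ E] [FiniteDimensional ℝ E]

/-- The dimension of a (nonempty) set: the dimension of its affine hull. -/
noncomputable def affDim (S : Set E) : ℕ :=
  Module.finrank ℝ (affineSpan ℝ S).direction

/-- The linear inequality `f x ≤ β` is facet defining for `Q`: it is valid for `Q`, and the face of
`Q` on which it holds with equality is nonempty and has dimension `dim Q - 1`. -/
def IsFacetDefining (Q : Set E) (f : E →ₗ[ℝ] ℝ) (β : ℝ) : Prop :=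
  (∀ x ∈ Q, f x ≤ β) ∧ {x ∈ Q | f x = β}.Nonempty ∧
    affDim {x ∈ Q | f x = β} + 1 = affDim Q

/-- `Q` is the solution set of a system of `e` linear equations and `m` linear inequalities, in
which no inequality is an equation in disguise: each inequality is strict at some point of `Q`. -/
def HasLinearDescription (Q : Set E) (e m : ℕ) : Prop :=
  ∃ (a : Fin e → E →ₗ[ℝ] ℝ) (α : Fin e → ℝ) (f : Fin m → E →ₗ[ℝ] ℝ) (β : Fin m → ℝ),
    Q = {x | (∀ s, a s x = α s) ∧ (∀ t, f t x ≤ β t)} ∧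
    ∀ t, ∃ x ∈ Q, f t x < β t

/-- The size of a polyhedron: the minimum number of linear inequalities in a linear description of
it, where each equation is counted as two inequalities. -/
noncomputable def polySize (Q : Set E) : ℕ :=
  sInf {N | ∃ e m : ℕ, HasLinearDescription Q e m ∧ N = 2 * e + m}

end Polyhedra

/-! ### Embeddings of a family of polyhedra and the SOS2 constraint

Vectors are indexed from `0`: the entry `λ_j` is `lam (j - 1)`, and `h^i` is `H (i - 1)`. -/

/-- The convex hull of the union of the sets `P^i × {h^i}`. -/
def embeddingHull {d n k : ℕ} (P : Fin n → Set (Fin d → ℝ)) (H : Fin n → Fin k → ℝ) :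
    Set ((Fin d → ℝ) × (Fin k → ℝ)) :=
  convexHull ℝ (⋃ i, P i ×ˢ {H i})

/-- The SOS2 constraint on the standard simplex in `ℝ^(n+1)`: the `i`-th polyhedron consists of the
points of the simplex whose entries other than `i` and `i + 1` are at most zero. -/
def sos2 (n : ℕ) (i : Fin n) : Set (Fin (n + 1) → ℝ) :=
  {lam | lam ∈ stdSimplex ℝ (Fin (n + 1)) ∧
    ∀ j, j ∉ ({i.castSucc, i.succ} : Set (Fin (n + 1))) → lam j ≤ 0}

/-- The unary encoding: `h^i` is the `i`-th unit vector of `ℝ^n`. -/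
def unaryEncoding (n : ℕ) (i : Fin n) : Fin n → ℝ := Pi.single i 1

/-! ### General inequalities and variable bounds for the SOS2 constraint with encoding `H` -/

section Sizes

variable {n k : ℕ} [NeZero n]

/-- The vector `h^m` for `0 ≤ m ≤ n + 1` (counted from one), with `h^0 = h^1` and
`h^(n+1) = h^n`. -/
def code (H : Fin n → Fin k → ℝ) (m : ℕ) : Fin k → ℝ :=
  H ⟨min (m - 1) (n - 1), by have := NeZero.pos n; omega⟩

/-- The difference `c^i = h^(i+1) - h^i`, for `1 ≤ i ≤ n - 1`. -/
def codeDiff (H : Fin n → Fin k → ℝ) (i : ℕ) : Fin k → ℝ :=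
  code H (i + 1) - code H i

/-- `L(H)`, the linear space parallel to the affine hull of `H`. -/
def codeSpace (H : Fin n → Fin k → ℝ) : Submodule ℝ (Fin k → ℝ) :=
  (affineSpan ℝ (Set.range H)).direction

/-- `M(b)`, the linear hyperplane of `L(H)` defined by `b`. -/
def codeHyperplane (H : Fin n → Fin k → ℝ) (b : Fin k → ℝ) : Set (Fin k → ℝ) :=
  {y | y ∈ codeSpace H ∧ b ⬝ᵥ y = 0}

/-- `b` is a nonzero vector of `L(H)` and the hyperplane `M(b)` of `L(H)` is spanned by some of the
vectors `c^1, …, c^(n-1)`. -/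
def IsSpannedNormal (H : Fin n → Fin k → ℝ) (b : Fin k → ℝ) : Prop :=
  b ∈ codeSpace H ∧ b ≠ 0 ∧
    ∃ S ⊆ Set.Icc 1 (n - 1),
      codeHyperplane H b = (Submodule.span ℝ (codeDiff H '' S) : Set (Fin k → ℝ))

/-- The general inequalities
`∑ j, min (b · h^j) (b · h^(j-1)) * λ_j ≤ b · y` and
`b · y ≤ ∑ j, max (b · h^j) (b · h^(j-1)) * λ_j`, for the spanned hyperplanes `M(b)`.
An inequality is represented by the half-space of its solutions, so that the normals `s • b`,
`s ≠ 0`, of one hyperplane together contribute one pair of inequalities. -/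
def generalInequalities (H : Fin n → Fin k → ℝ) :
    Set (Set ((Fin (n + 1) → ℝ) × (Fin k → ℝ))) :=
  {W | ∃ b, IsSpannedNormal H b ∧
    (W = {p | ∑ j : Fin (n + 1),
            min (b ⬝ᵥ code H ((j : ℕ) + 1)) (b ⬝ᵥ code H (j : ℕ)) * p.1 j ≤ b ⬝ᵥ p.2} ∨
      W = {p | b ⬝ᵥ p.2 ≤ ∑ j : Fin (n + 1),
            max (b ⬝ᵥ code H ((j : ℕ) + 1)) (b ⬝ᵥ code H (j : ℕ)) * p.1 j})}

/-- The index set `J` (counted from one) of the variable bounds. -/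
def boundIndices (H : Fin n → Fin k → ℝ) : Set ℕ :=
  {1, n + 1} ∪ {j | j ∈ Set.Icc 2 n ∧
    codeSpace H = Submodule.span ℝ (codeDiff H '' (Set.Icc 1 (n - 1) \ {j - 1}))}

/-- The variable bounds `λ_j ≥ 0` for `j ∈ J`, represented by half-spaces. -/
def boundInequalities (H : Fin n → Fin k → ℝ) :
    Set (Set ((Fin (n + 1) → ℝ) × (Fin k → ℝ))) :=
  {W | ∃ j : Fin (n + 1), (j : ℕ) + 1 ∈ boundIndices H ∧ W = {p | 0 ≤ p.1 j}}

/-- The number of general inequalities. -/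
noncomputable def sizeG (H : Fin n → Fin k → ℝ) : ℕ := (generalInequalities H).ncard

/-- The number of variable bounds. -/
noncomputable def sizeB (H : Fin n → Fin k → ℝ) : ℕ := (boundInequalities H).ncard

end Sizes

/-! ### Coordinates of `(λ, y)` as linear functionals -/

/-- The coordinate functional `(λ, y) ↦ λ_j`. -/
def lamCoord {d k : ℕ} (j : Fin d) : ((Fin d → ℝ) × (Fin k → ℝ)) →ₗ[ℝ] ℝ :=
  LinearMap.proj j ∘ₗ LinearMap.fst ℝ (Fin d → ℝ) (Fin k → ℝ)

/-- The coordinate functional `(λ, y) ↦ y_i`. -/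
def yCoord {d k : ℕ} (i : Fin k) : ((Fin d → ℝ) × (Fin k → ℝ)) →ₗ[ℝ] ℝ :=
  LinearMap.proj i ∘ₗ LinearMap.snd ℝ (Fin d → ℝ) (Fin k → ℝ)

/-! In terms of the partial sums `Λ_m = λ_1 + ⋯ + λ_m` and `Y_m = y_1 + ⋯ + y_m`, the vertices of
`Q(P, H)` for the unary encoding are the `2n` zero-one chains
`0 = Y_0 ≤ Λ_1 ≤ Y_1 ≤ Λ_2 ≤ ⋯ ≤ Λ_n ≤ Y_n = 1`, so `Q(P, H)` is the simplex of all such chains. The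
gaps of the chain are its barycentric coordinates, and they are the inequalities (2) and (3). In any
linear description, distinct facets require distinct inequalities and the codimension of the
polyhedron requires as many equations, which gives the size `2 * 2 + 2n`.

When the codes are affinely independent, the differences `c^1, …, c^(n-1)` form a basis of `L(H)`,
and the normals of the hyperplanes spanned by some of them are exactly the nonzero multiples of the
dual basis vectors. Their signs distinguish `2(n - 1)` half-spaces, and omitting any `c^i` lowers
the dimension of the span, so only the bounds on `λ_1` and `λ_{n+1}` remain. -/

/-! ### Facets and linear descriptions -/

section Polyhedra

variable {E : Type*} [AddCommGroup E] [Module ℝ E]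

theorem direction_affineSpan_le_ker {F : Set E} {g : E →ₗ[ℝ] ℝ} {γ : ℝ} (hF : ∀ x ∈ F, g x = γ) :
    (affineSpan ℝ F).direction ≤ LinearMap.ker g := by
  rw [direction_affineSpan, vectorSpan_def, Submodule.span_le]
  rintro _ ⟨x, hx, y, hy, rfl⟩
  simp [hF x hx, hF y hy]

theorem sub_mem_direction_affineSpan {Q : Set E} {x y : E} (hx : x ∈ Q) (hy : y ∈ Q) :
    x - y ∈ (affineSpan ℝ Q).direction :=
  AffineSubspace.vsub_mem_direction (subset_affineSpan ℝ Q hx) (subset_affineSpan ℝ Q hy)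

theorem affDim_convexHull_range {ι : Type*} [Fintype ι] {v : ι → E} (hv : AffineIndependent ℝ v)
    {d : ℕ} (hd : Fintype.card ι = d + 1) : affDim (convexHull ℝ (Set.range v)) = d := by
  rw [affDim, affineSpan_convexHull, direction_affineSpan, hv.finrank_vectorSpan hd]

theorem exists_pos_forall_add_mul_le {τ : Type*} [Finite τ] {c β : τ → ℝ} (d : τ → ℝ)
    (h : ∀ t, c t < β t) : ∃ ε > 0, ∀ t, c t + ε * d t ≤ β t := by
  have hnear : ∀ᶠ ε in nhdsWithin (0 : ℝ) (Set.Ioi 0), ∀ t, c t + ε * d t ≤ β t := by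
    refine Filter.eventually_all.2 fun t => ?_
    have hc : Filter.Tendsto (fun ε : ℝ => c t + ε * d t) (nhdsWithin 0 (Set.Ioi 0))
        (nhds (c t + 0 * d t)) :=
      (Continuous.tendsto (by fun_prop) 0).mono_left nhdsWithin_le_nhds
    exact (hc.eventually_lt_const (by simpa using h t)).mono fun _ => le_of_lt
  obtain ⟨ε, hle, hpos⟩ := (hnear.and self_mem_nhdsWithin).exists
  exact ⟨ε, hpos, hle⟩

theorem exists_forall_lt_of_convexOn {τ : Type*} [Finite τ] {F : Set E} (hF : F.Nonempty)
    {f : τ → E → ℝ} {β : τ → ℝ} (hf : ∀ t, ConvexOn ℝ F (f t)) (hle : ∀ t, ∀ x ∈ F, f t x ≤ β t)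
    (hlt : ∀ t, ∃ x ∈ F, f t x < β t) : ∃ p ∈ F, ∀ t, f t p < β t := by
  classical
  have := Fintype.ofFinite τ
  suffices h : ∀ s : Finset τ, ∃ p ∈ F, ∀ t ∈ s, f t p < β t by
    simpa using h Finset.univ
  intro s
  induction s using Finset.induction_on with
  | empty => exact hF.imp fun _ hp => ⟨hp, by simp⟩
  | insert a s _ ih =>
    obtain ⟨p, hp, hps⟩ := ih
    obtain ⟨q, hq, hqa⟩ := hlt a
    refine ⟨(1 / 2 : ℝ) • p + (1 / 2 : ℝ) • q,
      (hf a).1 hp hq (by norm_num) (by norm_num) (by norm_num), fun t ht => ?_⟩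
    have hmid : f t ((1 / 2 : ℝ) • p + (1 / 2 : ℝ) • q) ≤ 1 / 2 * f t p + 1 / 2 * f t q :=
      (hf t).2 hp hq (by norm_num) (by norm_num) (by norm_num)
    rcases Finset.mem_insert.1 ht with rfl | hts
    · linarith [hle t p hp]
    · linarith [hle t q hq, hps t hts]

theorem IsFacetDefining.congr {Q : Set E} {f g : E →ₗ[ℝ] ℝ} {β : ℝ} (hf : IsFacetDefining Q f β)
    (hfg : ∀ x ∈ Q, f x = g x) : IsFacetDefining Q g β := by
  have hface : {x ∈ Q | g x = β} = {x ∈ Q | f x = β} :=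
    Set.sep_ext_iff.2 fun x hx => by rw [hfg x hx]
  rw [IsFacetDefining, hface]
  exact ⟨fun x hx => hfg x hx ▸ hf.1 x hx, hf.2⟩

theorem IsFacetDefining.exists_lt {Q : Set E} {f : E →ₗ[ℝ] ℝ} {β : ℝ}
    (hf : IsFacetDefining Q f β) : ∃ x ∈ Q, f x < β := by
  by_contra! h
  have hface : {x ∈ Q | f x = β} = Q :=
    Set.sep_eq_self_iff_mem_true.2 fun x hx => (hf.1 x hx).antisymm (h x hx)
  have hdim := hf.2.2
  rw [hface] at hdim
  omega

theorem HasLinearDescription.convex {Q : Set E} {e m : ℕ} (h : HasLinearDescription Q e m) :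
    Convex ℝ Q := by
  obtain ⟨a, α, f, β, rfl, -⟩ := h
  simp only [Set.ofPred_and, Set.ofPred_forall]
  exact (convex_iInter fun s => convex_hyperplane (a s).isLinear _).inter
    (convex_iInter fun t => convex_halfSpace_le (f t).isLinear _)

/-- If no inequality were tight on the facet, one could leave `Q` through a point of the facet while
satisfying the description. -/
theorem IsFacetDefining.exists_tight {Q : Set E} {f : E →ₗ[ℝ] ℝ} {β : ℝ}
    (hf : IsFacetDefining Q f β) {e m : ℕ} {a : Fin e → E →ₗ[ℝ] ℝ} {α : Fin e → ℝ}
    {g : Fin m → E →ₗ[ℝ] ℝ} {γ : Fin m → ℝ}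
    (hQ : ∀ x, x ∈ Q ↔ (∀ s, a s x = α s) ∧ ∀ t, g t x ≤ γ t) (hconv : Convex ℝ Q) :
    ∃ t, ∀ x ∈ Q, f x = β → g t x = γ t := by
  by_contra! hcon
  have hle : ∀ t, ∀ x ∈ Q, g t x ≤ γ t := fun t x hx => ((hQ x).1 hx).2 t
  have hlt : ∀ t, ∃ x ∈ {x ∈ Q | f x = β}, g t x < γ t := fun t => by
    obtain ⟨x, hx, hxβ, hxγ⟩ := hcon t
    exact ⟨x, ⟨hx, hxβ⟩, (hle t x hx).lt_of_ne hxγ⟩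
  obtain ⟨p, ⟨hp, hpβ⟩, hpγ⟩ := exists_forall_lt_of_convexOn hf.2.1
    (fun t => (g t).convexOn (hconv.inter (convex_hyperplane f.isLinear β)))
    (fun t x hx => hle t x hx.1) hlt
  obtain ⟨q, hq, hqβ⟩ := hf.exists_lt
  obtain ⟨ε, hε, hεγ⟩ := exists_pos_forall_add_mul_le (fun t => g t (p - q)) hpγ
  have hmem : p + ε • (p - q) ∈ Q :=
    (hQ _).2 ⟨fun s => by simp [((hQ p).1 hp).1 s, ((hQ q).1 hq).1 s], fun t => by
      simpa using hεγ t⟩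
  have hvalid := hf.1 _ hmem
  rw [map_add, map_smul, map_sub, hpβ, smul_eq_mul] at hvalid
  linarith [mul_pos hε (sub_pos.2 hqβ)]

variable [FiniteDimensional ℝ E]

theorem affDim_mono {F Q : Set E} (hFQ : F ⊆ Q) : affDim F ≤ affDim Q :=
  Submodule.finrank_mono (AffineSubspace.direction_le (affineSpan_mono ℝ hFQ))

theorem affDim_lt_affDim {F Q : Set E} (hFQ : F ⊆ Q) (hne : F.Nonempty) {g : E →ₗ[ℝ] ℝ} {γ : ℝ}
    (hF : ∀ x ∈ F, g x = γ) (hQ : ∃ x ∈ Q, g x ≠ γ) : affDim F < affDim Q := by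
  obtain ⟨p, hp⟩ := hne
  obtain ⟨q, hq, hqγ⟩ := hQ
  refine Submodule.finrank_lt_finrank_of_lt
    (lt_of_le_of_ne (AffineSubspace.direction_le (affineSpan_mono ℝ hFQ)) fun heq => hqγ ?_)
  have hker : q - p ∈ LinearMap.ker g :=
    direction_affineSpan_le_ker hF (heq ▸ sub_mem_direction_affineSpan hq (hFQ hp))
  rwa [LinearMap.mem_ker, map_sub, hF p hp, sub_eq_zero] at hker

theorem IsFacetDefining.face_eq {Q : Set E} {f g : E →ₗ[ℝ] ℝ} {β γ : ℝ}
    (hf : IsFacetDefining Q f β) (hg : ∀ x ∈ Q, f x = β → g x = γ) (hQ : ∃ x ∈ Q, g x ≠ γ) :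
    {x ∈ Q | f x = β} = {x ∈ Q | g x = γ} := by
  obtain ⟨-, ⟨p, hp⟩, hdim⟩ := hf
  have hsub : {x ∈ Q | f x = β} ⊆ {x ∈ Q | g x = γ} := fun x hx => ⟨hx.1, hg x hx.1 hx.2⟩
  refine hsub.antisymm fun x hx => ⟨hx.1, ?_⟩
  have hlt : affDim {x ∈ Q | g x = γ} < affDim Q :=
    affDim_lt_affDim (Set.sep_subset _ _) ⟨p, hsub hp⟩ (fun _ h => h.2) hQ
  have hdir : (affineSpan ℝ {x ∈ Q | f x = β}).direction =
      (affineSpan ℝ {x ∈ Q | g x = γ}).direction :=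
    Submodule.eq_of_le_of_finrank_le (AffineSubspace.direction_le (affineSpan_mono ℝ hsub))
      (Nat.lt_succ_iff.1 (hlt.trans_eq hdim.symm))
  have hker : x - p ∈ LinearMap.ker f :=
    direction_affineSpan_le_ker (fun _ h => h.2)
      (hdir ▸ sub_mem_direction_affineSpan hx (hsub hp))
  rwa [LinearMap.mem_ker, map_sub, hp.2, sub_eq_zero] at hker

theorem isFacetDefining_convexHull_range {ι : Type*} [Finite ι] [Nontrivial ι] {v : ι → E}
    (hv : AffineIndependent ℝ v) {f : E →ₗ[ℝ] ℝ} {β : ℝ} {i : ι} (hi : f (v i) < β)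
    (hne : ∀ j, j ≠ i → f (v j) = β) : IsFacetDefining (convexHull ℝ (Set.range v)) f β := by
  classical
  have hmem : ∀ j, v j ∈ convexHull ℝ (Set.range v) := fun j => subset_convexHull ℝ _ ⟨j, rfl⟩
  have hvalid : ∀ x ∈ convexHull ℝ (Set.range v), f x ≤ β := by
    refine convexHull_min ?_ (convex_halfSpace_le f.isLinear β)
    rintro _ ⟨j, rfl⟩
    by_cases hj : j = i
    · exact hj ▸ hi.le
    · exact (hne j hj).le
  obtain ⟨j, hj⟩ := exists_ne i
  have hface : {x ∈ convexHull ℝ (Set.range v) | f x = β}.Nonempty := ⟨v j, hmem j, hne j hj⟩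
  have := Fintype.ofFinite ι
  refine ⟨hvalid, hface, ?_⟩
  have hlt : affDim {x ∈ convexHull ℝ (Set.range v) | f x = β} <
      affDim (convexHull ℝ (Set.range v)) :=
    affDim_lt_affDim (Set.sep_subset _ _) hface (fun _ h => h.2) ⟨v i, hmem i, hi.ne⟩
  have hsub : convexHull ℝ (Set.range fun j : {j // j ≠ i} => v j) ⊆
      {x ∈ convexHull ℝ (Set.range v) | f x = β} := by
    refine convexHull_min ?_
      ((convex_convexHull ℝ _).inter (convex_hyperplane f.isLinear β))
    rintro _ ⟨⟨j, hj⟩, rfl⟩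
    exact ⟨hmem j, hne j hj⟩
  obtain ⟨d, hd⟩ : ∃ d, Fintype.card ι = d + 2 :=
    Nat.exists_eq_add_of_le' Fintype.one_lt_card
  have hd' : Fintype.card {j // j ≠ i} = d + 1 := by
    simp [hd]
  have hfacet : affDim (convexHull ℝ (Set.range fun j : {j // j ≠ i} => v j)) = d :=
    affDim_convexHull_range (hv.comp_embedding (Function.Embedding.subtype (· ≠ i))) hd'
  have hle := affDim_mono hsub
  rw [affDim_convexHull_range hv hd] at hlt ⊢
  omega

/-- The equations of a description cut out the affine hull, because at a point where no inequality
is tight every direction killed by the equations stays in `Q`. -/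
theorem HasLinearDescription.finrank_le {Q : Set E} {e m : ℕ} (h : HasLinearDescription Q e m)
    (hne : Q.Nonempty) : Module.finrank ℝ E ≤ e + affDim Q := by
  have hconv := h.convex
  obtain ⟨a, α, f, β, hQ, hlt⟩ := h
  have hQ' : ∀ x, x ∈ Q ↔ (∀ s, a s x = α s) ∧ ∀ t, f t x ≤ β t := fun x => by rw [hQ]; rfl
  obtain ⟨p, hp, hpβ⟩ := exists_forall_lt_of_convexOn hne (fun t => (f t).convexOn hconv)
    (fun t x hx => ((hQ' x).1 hx).2 t) hlt
  have hker : LinearMap.ker (LinearMap.pi a) ≤ (affineSpan ℝ Q).direction := by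
    intro w hw
    have haw : ∀ s, a s w = 0 := fun s => congrFun (LinearMap.mem_ker.1 hw) s
    obtain ⟨ε, hε, hεβ⟩ := exists_pos_forall_add_mul_le (fun t => f t w) hpβ
    have hmem : p + ε • w ∈ Q :=
      (hQ' _).2 ⟨fun s => by simp [haw, ((hQ' p).1 hp).1 s], fun t => by simpa using hεβ t⟩
    have hdir := sub_mem_direction_affineSpan hmem hp
    rw [add_sub_cancel_left] at hdir
    exact (Submodule.smul_mem_iff _ hε.ne').1 hdir
  calc Module.finrank ℝ E
      = Module.finrank ℝ (LinearMap.range (LinearMap.pi a)) +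
          Module.finrank ℝ (LinearMap.ker (LinearMap.pi a)) :=
        (LinearMap.finrank_range_add_finrank_ker _).symm
    _ ≤ Module.finrank ℝ (Fin e → ℝ) + affDim Q :=
        add_le_add (Submodule.finrank_le _) (Submodule.finrank_mono hker)
    _ = e + affDim Q := by rw [Module.finrank_fin_fun]

theorem HasLinearDescription.card_facets_le {Q : Set E} {e m : ℕ}
    (h : HasLinearDescription Q e m) {ι : Type*} [Fintype ι] {f : ι → E →ₗ[ℝ] ℝ} {β : ι → ℝ}
    (hf : ∀ i, IsFacetDefining Q (f i) (β i))
    (hinj : Function.Injective fun i => {x ∈ Q | f i x = β i}) : Fintype.card ι ≤ m := by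
  have hconv := h.convex
  obtain ⟨a, α, g, γ, hQ, hlt⟩ := h
  choose T hT using fun i => (hf i).exists_tight (fun x => by rw [hQ]; rfl) hconv
  have hface : ∀ i, {x ∈ Q | f i x = β i} = {x ∈ Q | g (T i) x = γ (T i)} := fun i =>
    (hf i).face_eq (hT i) ((hlt (T i)).imp fun _ h => ⟨h.1, h.2.ne⟩)
  have hTinj : Function.Injective T := fun i j hij => hinj <| by
    simp only [hface, hij]
  simpa using Fintype.card_le_of_injective T hTinj

theorem polySize_eq_of_isFacetDefining {Q : Set E} (hne : Q.Nonempty) {e : ℕ}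
    {a : Fin e → E →ₗ[ℝ] ℝ} {α : Fin e → ℝ} {ι : Type*} [Fintype ι] {f : ι → E →ₗ[ℝ] ℝ}
    {β : ι → ℝ} (hQ : Q = {x | (∀ s, a s x = α s) ∧ ∀ i, f i x ≤ β i})
    (hdim : e + affDim Q = Module.finrank ℝ E) (hf : ∀ i, IsFacetDefining Q (f i) (β i))
    (hinj : Function.Injective fun i => {x ∈ Q | f i x = β i}) :
    polySize Q = 2 * e + Fintype.card ι := by
  refine IsLeast.csInf_eq ⟨⟨e, Fintype.card ι, ?_, rfl⟩, ?_⟩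
  · let φ := (Fintype.equivFin ι).symm
    refine ⟨a, α, f ∘ φ, β ∘ φ, ?_, fun t => (hf (φ t)).exists_lt⟩
    rw [hQ]
    exact Set.ext fun x => and_congr_right' φ.forall_congr_right.symm
  · rintro _ ⟨e', m, h, rfl⟩
    have he : Module.finrank ℝ E ≤ e' + affDim Q := h.finrank_le hne
    have hm : Fintype.card ι ≤ m := h.card_facets_le hf hinj
    omega

end Polyhedra

section Simplices

variable {E : Type*} [AddCommGroup E] [Module ℝ E] {ι : Type*} {v : ι → E}
  {g : ι → E →ₗ[ℝ] ℝ}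

theorem convexHull_range_eq_sep_nonneg [Fintype ι] {A : Set E} (hA : Convex ℝ A) (hv : ∀ i, v i ∈ A)
    (hgv : ∀ i j, 0 ≤ g i (v j)) (hsum : ∀ x ∈ A, ∑ i, g i x = 1)
    (hrepr : ∀ x ∈ A, ∑ i, g i x • v i = x) :
    convexHull ℝ (Set.range v) = {x ∈ A | ∀ i, 0 ≤ g i x} := by
  apply (convexHull_min _ _).antisymm
  · rintro x ⟨hxA, hx⟩
    rw [← hrepr x hxA]
    exact (convex_convexHull ℝ _).sum_mem (fun i _ => hx i) (hsum x hxA)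
      fun i _ => subset_convexHull ℝ _ ⟨i, rfl⟩
  · rintro _ ⟨j, rfl⟩
    exact ⟨hv j, fun i => hgv i j⟩
  · simp only [Set.ofPred_and, Set.ofPred_forall]
    exact hA.inter (convex_iInter fun i => convex_halfSpace_ge (g i).isLinear _)

variable [DecidableEq ι]

theorem affineIndependent_of_biorthogonal (hgv : ∀ i j, g i (v j) = if i = j then 1 else 0) :
    AffineIndependent ℝ v :=
  (LinearIndependent.of_pairwise_dual_eq_zero_one v g (fun i j hij => by simp [hgv, hij])
    fun i => by simp [hgv]).affineIndependent

theorem injective_faces_of_biorthogonal (hgv : ∀ i j, g i (v j) = if i = j then 1 else 0) :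
    Function.Injective fun i => {x ∈ convexHull ℝ (Set.range v) | (-g i) x = 0} := by
  intro i j hij
  by_contra hne
  have hzero : (-g j) (v j) = 0 :=
    ((Set.ext_iff.1 hij (v j)).1 ⟨subset_convexHull ℝ _ ⟨j, rfl⟩, by simp [hgv, hne]⟩).2
  simp [hgv] at hzero

variable [FiniteDimensional ℝ E]

theorem isFacetDefining_neg_of_biorthogonal [Finite ι] [Nontrivial ι]
    (hgv : ∀ i j, g i (v j) = if i = j then 1 else 0) (i : ι) :
    IsFacetDefining (convexHull ℝ (Set.range v)) (-g i) 0 :=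
  isFacetDefining_convexHull_range (affineIndependent_of_biorthogonal hgv) (i := i)
    (by simp [hgv]) fun j hj => by simp [hgv, hj.symm]

theorem polySize_convexHull_range [Fintype ι] [Nontrivial ι]
    (hgv : ∀ i j, g i (v j) = if i = j then 1 else 0) {e : ℕ} {a : Fin e → E →ₗ[ℝ] ℝ}
    {α : Fin e → ℝ}
    (hQ : convexHull ℝ (Set.range v) = {x | (∀ s, a s x = α s) ∧ ∀ i, 0 ≤ g i x})
    (hdim : e + Fintype.card ι = Module.finrank ℝ E + 1) :
    polySize (convexHull ℝ (Set.range v)) = 2 * e + Fintype.card ι := by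
  obtain ⟨d, hd⟩ : ∃ d, Fintype.card ι = d + 1 :=
    Nat.exists_eq_add_of_le' Fintype.card_pos
  have haff := affDim_convexHull_range (affineIndependent_of_biorthogonal hgv) hd
  refine polySize_eq_of_isFacetDefining (Set.range_nonempty v).convexHull (a := a) (α := α)
    (f := fun i => -g i) (β := 0) ?_ (by omega) (isFacetDefining_neg_of_biorthogonal hgv)
    (injective_faces_of_biorthogonal hgv)
  simpa using hQ

end Simplices

/-! ### The SOS2 constraint with unary encoding as a simplex -/

section PartialSums

variable {k : ℕ}

/-- The functional `x ↦ x_1 + ⋯ + x_m`, for any `m` (all entries are summed when `k ≤ m`). -/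
def initialSum (m : ℕ) : (Fin k → ℝ) →ₗ[ℝ] ℝ :=
  ∑ i : Fin k with i.val < m, LinearMap.proj i

theorem initialSum_apply (m : ℕ) (x : Fin k → ℝ) :
    initialSum m x = ∑ i : Fin k with i.val < m, x i := by
  simp [initialSum]

theorem initialSum_zero (x : Fin k → ℝ) : initialSum 0 x = 0 := by
  simp [initialSum_apply]

theorem initialSum_self (x : Fin k → ℝ) : initialSum k x = ∑ i, x i := by
  simp [initialSum_apply]

theorem initialSum_add_one (i : Fin k) (x : Fin k → ℝ) :
    initialSum (i + 1) x = initialSum i x + x i := by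
  have hfilter : ({j : Fin k | j.val < i.val + 1} : Finset (Fin k)) =
      insert i ({j : Fin k | j.val < i.val} : Finset (Fin k)) := by
    grind
  rw [initialSum_apply, initialSum_apply, hfilter, Finset.sum_insert (by simp), add_comm]

theorem initialSum_single (m : ℕ) (i : Fin k) :
    initialSum m (Pi.single i 1) = if i.val < m then 1 else 0 := by
  simp [initialSum_apply, Pi.single_apply, Finset.sum_ite_eq']

theorem sum_filter_le_eq_sub_initialSum (m : ℕ) (x : Fin k → ℝ) :
    ∑ i : Fin k with m ≤ i.val, x i = ∑ i, x i - initialSum m x := by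
  rw [initialSum_apply, eq_sub_iff_add_eq']
  simpa using Finset.sum_filter_add_sum_filter_not Finset.univ (fun i : Fin k => i.val < m) x

theorem eq_zero_of_initialSum_eq_zero {x : Fin k → ℝ} (hx : ∀ m ≤ k, initialSum m x = 0) :
    x = 0 := by
  ext i
  simpa [hx _ i.2, hx _ i.2.le] using (initialSum_add_one i x).symm

end PartialSums

section SOS2

variable {n k : ℕ}

theorem sos2_eq_segment (i : Fin n) :
    sos2 n i = segment ℝ (Pi.single i.castSucc 1) (Pi.single i.succ 1) := by
  have hne : i.castSucc ≠ i.succ := i.castSucc_lt_succ.ne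
  apply Set.Subset.antisymm
  · rintro lam ⟨⟨hnonneg, hsum⟩, hsupp⟩
    have hzero : ∀ j, j ≠ i.castSucc ∧ j ≠ i.succ → lam j = 0 := fun j hj =>
      (hsupp j (by simpa using hj)).antisymm (hnonneg j)
    rw [Fintype.sum_eq_add _ _ hne hzero] at hsum
    refine ⟨_, _, hnonneg _, hnonneg _, hsum, funext fun j => ?_⟩
    rcases eq_or_ne j i.castSucc with rfl | h₁
    · simp [hne]
    · rcases eq_or_ne j i.succ with rfl | h₂
      · simp [hne.symm]
      · simp [h₁, h₂, hzero j ⟨h₁, h₂⟩]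
  · rintro lam hlam
    refine ⟨segment_single_subset_stdSimplex ℝ _ _ hlam, fun j hj => ?_⟩
    obtain ⟨a, b, -, -, -, rfl⟩ := hlam
    simp only [Set.mem_insert_iff, Set.mem_singleton_iff, not_or] at hj
    simp [hj.1, hj.2]

/-- The vertices `(e_i, h^i)` and `(e_{i+1}, h^i)` of the sets `P^i × {h^i}` for the SOS2
constraint. -/
def sos2Vertex (H : Fin n → Fin k → ℝ) : Fin n ⊕ Fin n → (Fin (n + 1) → ℝ) × (Fin k → ℝ)
  | .inl i => (Pi.single i.castSucc 1, H i)
  | .inr i => (Pi.single i.succ 1, H i)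

theorem embeddingHull_sos2 (H : Fin n → Fin k → ℝ) :
    embeddingHull (sos2 n) H = convexHull ℝ (Set.range (sos2Vertex H)) := by
  have hprod : ∀ i, sos2 n i ×ˢ {H i} =
      convexHull ℝ {sos2Vertex H (.inl i), sos2Vertex H (.inr i)} := fun i => by
    rw [sos2_eq_segment, ← convexHull_pair, ← convexHull_singleton (𝕜 := ℝ) (H i),
      ← convexHull_prod]
    simp [sos2Vertex, Set.insert_prod, segment_symm]
  have hrange : Set.range (sos2Vertex H) =
      ⋃ i, {sos2Vertex H (.inl i), sos2Vertex H (.inr i)} := by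
    ext x
    simp [exists_or, eq_comm]
  rw [embeddingHull, hrange]
  simp only [hprod]
  exact (convexHull ℝ).closure_iSup_closure _

/-- Writing `Λ_m` and `Y_m` for the sums of the first `m` entries of `λ` and `y`, the gaps
`Λ_{i+1} - Y_i` and `Y_{i+1} - Λ_{i+1}`, `0 ≤ i < n`, of the interlacing chain
`0 = Y_0 ≤ Λ_1 ≤ Y_1 ≤ ⋯ ≤ Λ_n ≤ Y_n`. -/
def interlacingGap (n : ℕ) : Fin n ⊕ Fin n → ((Fin (n + 1) → ℝ) × (Fin n → ℝ)) →ₗ[ℝ] ℝ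
  | .inl i => initialSum (i + 1) ∘ₗ LinearMap.fst ℝ _ _ - initialSum i ∘ₗ LinearMap.snd ℝ _ _
  | .inr i =>
    initialSum (i + 1) ∘ₗ LinearMap.snd ℝ _ _ - initialSum (i + 1) ∘ₗ LinearMap.fst ℝ _ _

theorem interlacingGap_inl (i : Fin n) (x : (Fin (n + 1) → ℝ) × (Fin n → ℝ)) :
    interlacingGap n (.inl i) x = initialSum (i + 1) x.1 - initialSum i x.2 := rfl

theorem interlacingGap_inr (i : Fin n) (x : (Fin (n + 1) → ℝ) × (Fin n → ℝ)) :
    interlacingGap n (.inr i) x = initialSum (i + 1) x.2 - initialSum (i + 1) x.1 := rfl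

theorem interlacingGap_sos2Vertex (s t : Fin n ⊕ Fin n) :
    interlacingGap n s (sos2Vertex (unaryEncoding n) t) = if s = t then 1 else 0 := by
  rcases s with i | i <;> rcases t with j | j <;>
    simp only [interlacingGap_inl, interlacingGap_inr, sos2Vertex, unaryEncoding,
      initialSum_single, Fin.val_castSucc, Fin.val_succ] <;>
    grind

theorem sum_interlacingGap (x : (Fin (n + 1) → ℝ) × (Fin n → ℝ)) :
    ∑ s, interlacingGap n s x = ∑ i, x.2 i := by
  rw [Fintype.sum_sum_type, ← Finset.sum_add_distrib]
  refine Finset.sum_congr rfl fun i _ => ?_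
  rw [interlacingGap_inl, interlacingGap_inr, initialSum_add_one i x.2]
  ring

theorem eq_zero_of_interlacingGap_eq_zero {x : (Fin (n + 1) → ℝ) × (Fin n → ℝ)}
    (hgap : ∀ s, interlacingGap n s x = 0) (hsum : ∑ j, x.1 j = 0) : x = 0 := by
  have hΛ : ∀ m < n, initialSum (m + 1) x.1 = initialSum m x.2 := fun m hm =>
    sub_eq_zero.1 (hgap (.inl ⟨m, hm⟩))
  have hYΛ : ∀ m < n, initialSum (m + 1) x.2 = initialSum (m + 1) x.1 := fun m hm =>
    sub_eq_zero.1 (hgap (.inr ⟨m, hm⟩))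
  have hY : ∀ m ≤ n, initialSum m x.2 = 0 := by
    intro m hm
    induction m with
    | zero => exact initialSum_zero _
    | succ m ih => rw [hYΛ m hm, hΛ m hm, ih (by omega)]
  have hΛ₀ : ∀ m ≤ n + 1, initialSum m x.1 = 0 := by
    rintro (_ | m) hm
    · exact initialSum_zero _
    · rcases (Nat.le_of_succ_le_succ hm).eq_or_lt with rfl | hlt
      · rw [initialSum_self, hsum]
      · rw [hΛ m hlt, hY m hlt.le]
  exact Prod.ext (eq_zero_of_initialSum_eq_zero hΛ₀) (eq_zero_of_initialSum_eq_zero hY)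

theorem sum_interlacingGap_smul_sos2Vertex {x : (Fin (n + 1) → ℝ) × (Fin n → ℝ)}
    (hx : ∑ j, x.1 j = ∑ i, x.2 i) :
    ∑ s, interlacingGap n s x • sos2Vertex (unaryEncoding n) s = x := by
  have hone : ∀ s, ∑ j, (sos2Vertex (unaryEncoding n) s).1 j = 1 := by
    rintro (i | i) <;> simp [sos2Vertex]
  refine sub_eq_zero.1 (eq_zero_of_interlacingGap_eq_zero (fun s => ?_) ?_)
  · simp only [map_sub, map_sum, map_smul, interlacingGap_sos2Vertex, smul_eq_mul, mul_ite,
      mul_one, mul_zero, Finset.sum_ite_eq, Finset.mem_univ, if_true, sub_self]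
  · simp only [Prod.fst_sub, Prod.fst_sum, Prod.smul_fst, Pi.sub_apply, Finset.sum_apply,
      Pi.smul_apply, smul_eq_mul, Finset.sum_sub_distrib]
    rw [Finset.sum_comm]
    simp only [← Finset.mul_sum, hone, mul_one, sum_interlacingGap, hx, sub_self]

theorem embeddingHull_sos2_unaryEncoding :
    embeddingHull (sos2 n) (unaryEncoding n) =
      {x | (∑ j, x.1 j = 1 ∧ ∑ i, x.2 i = 1) ∧ ∀ s, 0 ≤ interlacingGap n s x} := by
  let A : Set ((Fin (n + 1) → ℝ) × (Fin n → ℝ)) := {x | ∑ j, x.1 j = 1 ∧ ∑ i, x.2 i = 1}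
  have hA : Convex ℝ A := by
    intro x hx y hy a b _ _ hab
    simp [A, Finset.sum_add_distrib, ← Finset.mul_sum, hx.1, hx.2, hy.1, hy.2, hab]
  rw [embeddingHull_sos2]
  refine convexHull_range_eq_sep_nonneg (A := A) hA ?_ (fun s t => ?_) (fun x hx => ?_)
    fun x hx => ?_
  · rintro (i | i) <;> simp [A, sos2Vertex, unaryEncoding]
  · rw [interlacingGap_sos2Vertex]
    positivity
  · exact (sum_interlacingGap x).trans hx.2
  · exact sum_interlacingGap_smul_sos2Vertex (hx.1.trans hx.2.symm)

theorem sum_sub_sum_tail_eq_neg_interlacingGap {x : (Fin (n + 1) → ℝ) × (Fin n → ℝ)}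
    (hx : ∑ j, x.1 j = ∑ i, x.2 i) (l : Fin n) :
    ∑ j : Fin (n + 1) with l.val + 2 ≤ j.val + 1, x.1 j -
      ∑ i : Fin n with l.val + 1 ≤ i.val + 1, x.2 i = -interlacingGap n (.inl l) x := by
  simp only [interlacingGap_inl, Nat.add_le_add_iff_right, sum_filter_le_eq_sub_initialSum, hx,
    show ∀ m, l.val + 2 ≤ m + 1 ↔ l.val + 1 ≤ m by omega]
  ring

theorem sum_sub_sum_head_eq_neg_interlacingGap (l : Fin n)
    (x : (Fin (n + 1) → ℝ) × (Fin n → ℝ)) :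
    ∑ j : Fin (n + 1) with j.val + 1 ≤ l.val + 1, x.1 j -
      ∑ i : Fin n with i.val + 1 ≤ l.val + 1, x.2 i = -interlacingGap n (.inr l) x := by
  simp only [interlacingGap_inr, initialSum_apply, Nat.succ_le_iff, neg_sub]

section NeZero

variable [NeZero n]

theorem interlacingGap_inl_zero (x : (Fin (n + 1) → ℝ) × (Fin n → ℝ)) :
    interlacingGap n (.inl 0) x = x.1 0 := by
  simpa [interlacingGap_inl, initialSum_zero] using initialSum_add_one 0 x.1

theorem interlacingGap_inr_top {x : (Fin (n + 1) → ℝ) × (Fin n → ℝ)}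
    (hx : ∑ j, x.1 j = ∑ i, x.2 i) : interlacingGap n (.inr ⊤) x = x.1 (Fin.last n) := by
  have htop : (⊤ : Fin n).val + 1 = n := Nat.sub_add_cancel NeZero.one_le
  have hlast := initialSum_add_one (Fin.last n) x.1
  rw [Fin.val_last, initialSum_self] at hlast
  rw [interlacingGap_inr, htop, initialSum_self, ← hx, hlast]
  ring

theorem forall_interlacingGap_nonneg_iff {x : (Fin (n + 1) → ℝ) × (Fin n → ℝ)}
    (hx : ∑ j, x.1 j = ∑ i, x.2 i) :
    (∀ s, 0 ≤ interlacingGap n s x) ↔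
      (∀ l ∈ Finset.Icc 1 (n - 1),
        (∑ j : Fin (n + 1) with l + 2 ≤ j.val + 1, x.1 j
            ≤ ∑ i : Fin n with l + 1 ≤ i.val + 1, x.2 i) ∧
        (∑ j : Fin (n + 1) with j.val + 1 ≤ l, x.1 j
            ≤ ∑ i : Fin n with i.val + 1 ≤ l, x.2 i)) ∧
      0 ≤ x.1 0 ∧ 0 ≤ x.1 (Fin.last n) := by
  have htail : ∀ l : Fin n, 0 ≤ interlacingGap n (.inl l) x ↔
      ∑ j : Fin (n + 1) with l.val + 2 ≤ j.val + 1, x.1 j ≤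
        ∑ i : Fin n with l.val + 1 ≤ i.val + 1, x.2 i := fun l => by
    rw [← neg_nonpos, ← sum_sub_sum_tail_eq_neg_interlacingGap hx, sub_nonpos]
  have hhead : ∀ l : Fin n, 0 ≤ interlacingGap n (.inr l) x ↔
      ∑ j : Fin (n + 1) with j.val + 1 ≤ l.val + 1, x.1 j ≤
        ∑ i : Fin n with i.val + 1 ≤ l.val + 1, x.2 i := fun l => by
    rw [← neg_nonpos, ← sum_sub_sum_head_eq_neg_interlacingGap, sub_nonpos]
  simp only [Finset.mem_Icc]
  constructor
  · intro h
    refine ⟨?_, ?_, ?_⟩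
    · rintro l ⟨hl, hln⟩
      obtain ⟨l, rfl⟩ := Nat.exists_eq_add_of_le' hl
      exact ⟨(htail ⟨l + 1, by omega⟩).1 (h _), (hhead ⟨l, by omega⟩).1 (h _)⟩
    · exact interlacingGap_inl_zero x ▸ h _
    · exact interlacingGap_inr_top hx ▸ h _
  · rintro ⟨h, hfirst, hlast⟩ (l | l)
    · rcases eq_or_ne l 0 with rfl | hl
      · rwa [interlacingGap_inl_zero]
      · have hl' : l.val ≠ 0 := Fin.val_ne_zero_iff.2 hl
        exact (htail l).2 (h l ⟨by omega, by omega⟩).1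
    · rcases eq_or_ne l ⊤ with rfl | hl
      · rwa [interlacingGap_inr_top hx]
      · have hl' : l.val ≠ n - 1 := fun h => hl (Fin.ext h)
        exact (hhead l).2 (h (l + 1) ⟨by omega, by omega⟩).2

theorem isFacetDefining_of_eq_neg_interlacingGap
    {f : ((Fin (n + 1) → ℝ) × (Fin n → ℝ)) →ₗ[ℝ] ℝ} (s : Fin n ⊕ Fin n)
    (hf : ∀ x, ∑ j, x.1 j = ∑ i, x.2 i → f x = -interlacingGap n s x) :
    IsFacetDefining (embeddingHull (sos2 n) (unaryEncoding n)) f 0 := by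
  have : Nontrivial (Fin n ⊕ Fin n) := ⟨.inl 0, .inr 0, Sum.inl_ne_inr⟩
  have hgap : IsFacetDefining (embeddingHull (sos2 n) (unaryEncoding n)) (-interlacingGap n s) 0 :=
    embeddingHull_sos2 (unaryEncoding n) ▸
      isFacetDefining_neg_of_biorthogonal interlacingGap_sos2Vertex s
  refine hgap.congr fun x hx => (hf x ?_).symm
  rw [embeddingHull_sos2_unaryEncoding] at hx
  exact hx.1.1.trans hx.1.2.symm

theorem isFacetDefining_sum_tail (l : Fin n) :
    IsFacetDefining (embeddingHull (sos2 n) (unaryEncoding n))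
      ((∑ j : Fin (n + 1) with l.val + 2 ≤ j.val + 1, lamCoord j)
        - (∑ i : Fin n with l.val + 1 ≤ i.val + 1, yCoord i)) 0 :=
  isFacetDefining_of_eq_neg_interlacingGap (.inl l) fun x hx => by
    simpa [lamCoord, yCoord] using sum_sub_sum_tail_eq_neg_interlacingGap hx l

theorem isFacetDefining_sum_head (l : Fin n) :
    IsFacetDefining (embeddingHull (sos2 n) (unaryEncoding n))
      ((∑ j : Fin (n + 1) with j.val + 1 ≤ l.val + 1, lamCoord j)
        - (∑ i : Fin n with i.val + 1 ≤ l.val + 1, yCoord i)) 0 :=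
  isFacetDefining_of_eq_neg_interlacingGap (.inr l) fun x _ => by
    simpa [lamCoord, yCoord] using sum_sub_sum_head_eq_neg_interlacingGap l x

theorem isFacetDefining_neg_lamCoord_zero :
    IsFacetDefining (embeddingHull (sos2 n) (unaryEncoding n)) (-lamCoord 0) 0 :=
  isFacetDefining_of_eq_neg_interlacingGap (.inl 0) fun x _ => by
    simp [lamCoord, interlacingGap_inl_zero]

theorem isFacetDefining_neg_lamCoord_last :
    IsFacetDefining (embeddingHull (sos2 n) (unaryEncoding n)) (-lamCoord (Fin.last n)) 0 :=
  isFacetDefining_of_eq_neg_interlacingGap (.inr ⊤) fun x hx => by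
    simp [lamCoord, interlacingGap_inr_top hx]

theorem polySize_embeddingHull_sos2_unaryEncoding :
    polySize (embeddingHull (sos2 n) (unaryEncoding n)) = 2 * n + 4 := by
  have : Nontrivial (Fin n ⊕ Fin n) := ⟨.inl 0, .inr 0, Sum.inl_ne_inr⟩
  have hQ := embeddingHull_sos2_unaryEncoding (n := n)
  rw [embeddingHull_sos2] at hQ ⊢
  rw [polySize_convexHull_range interlacingGap_sos2Vertex (a := ![∑ j, lamCoord j, ∑ i, yCoord i])
    (α := 1)]
  · simp only [Fintype.card_sum, Fintype.card_fin]
    ring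
  · simpa [Fin.forall_fin_two, lamCoord, yCoord] using hQ
  · simp only [Fintype.card_sum, Fintype.card_fin, Module.finrank_prod, Module.finrank_fin_fun]
    ring

end NeZero

end SOS2

/-! ### Spanned hyperplanes for affinely independent codes -/

section DotProduct

variable {κ : Type*} [Fintype κ]

theorem eq_zero_of_mem_span_of_dotProduct_eq_zero {s : Set (κ → ℝ)} {y : κ → ℝ}
    (hy : y ∈ Submodule.span ℝ s) (hs : ∀ z ∈ s, y ⬝ᵥ z = 0) : y = 0 := by
  have hker : Submodule.span ℝ s ≤ LinearMap.ker (dotProductBilin ℝ ℝ y) :=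
    Submodule.span_le.2 hs
  exact dotProduct_self_eq_zero.1 (hker hy)

theorem exists_dual_of_linearIndependent {ι : Type*} [Finite ι] [DecidableEq ι]
    {c : ι → κ → ℝ} (hc : LinearIndependent ℝ c) :
    ∃ b : ι → κ → ℝ, (∀ i, b i ∈ Submodule.span ℝ (Set.range c)) ∧
      ∀ i j, b i ⬝ᵥ c j = if i = j then 1 else 0 := by
  have := Fintype.ofFinite ι
  let T : Submodule.span ℝ (Set.range c) →ₗ[ℝ] ι → ℝ :=
    LinearMap.pi (fun i => dotProductBilin ℝ ℝ (c i)) ∘ₗ Submodule.subtype _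
  have hT : ∀ y i, T y i = y.1 ⬝ᵥ c i := fun y i => dotProduct_comm (c i) y.1
  have hinj : Function.Injective T := by
    refine (injective_iff_map_eq_zero T).2 fun y hy => Subtype.ext ?_
    refine eq_zero_of_mem_span_of_dotProduct_eq_zero y.2 ?_
    rintro _ ⟨i, rfl⟩
    rw [← hT, hy, Pi.zero_apply]
  have hsurj : Function.Surjective T :=
    (LinearMap.injective_iff_surjective_of_finrank_eq_finrank
      (by rw [finrank_span_eq_card hc, Module.finrank_fintype_fun_eq_card])).1 hinj
  choose b hb using fun i => hsurj (Pi.single i 1)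
  refine ⟨fun i => b i, fun i => (b i).2, fun i j => ?_⟩
  rw [← hT, hb, Pi.single_apply]
  exact if_congr eq_comm rfl rfl

end DotProduct

theorem injective_setOf_nonneg_fst_apply {ι F : Type*} [Zero F] :
    Function.Injective fun j : ι => {p : (ι → ℝ) × F | 0 ≤ p.1 j} := by
  classical
  intro i j hij
  by_contra hne
  have hiff := Set.ext_iff.1 hij (Pi.single i (-1), 0)
  norm_num [Ne.symm hne] at hiff

section Sizes

variable {n k : ℕ} [NeZero n] {H : Fin n → Fin k → ℝ}

theorem codeDiff_mem_codeSpace (H : Fin n → Fin k → ℝ) (i : ℕ) : codeDiff H i ∈ codeSpace H :=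
  AffineSubspace.vsub_mem_direction (mem_affineSpan ℝ ⟨_, rfl⟩) (mem_affineSpan ℝ ⟨_, rfl⟩)

theorem codeSpace_eq_span (H : Fin n → Fin k → ℝ) :
    codeSpace H = Submodule.span ℝ (codeDiff H '' Set.Icc 1 (n - 1)) := by
  have hcode : ∀ i : Fin n, H i = code H (i + 1) := fun i => by
    rw [code]
    congr 1
    ext
    simp only [Nat.add_sub_cancel]
    omega
  have hmem : ∀ m, 1 ≤ m → m ≤ n →
      code H m - code H 1 ∈ Submodule.span ℝ (codeDiff H '' Set.Icc 1 (n - 1)) := by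
    intro m hm
    induction m, hm using Nat.le_induction with
    | base => simp
    | succ m hm ih =>
      intro hmn
      rw [← sub_add_sub_cancel _ (code H m)]
      exact add_mem (Submodule.subset_span ⟨m, ⟨hm, by omega⟩, rfl⟩) (ih (by omega))
  apply le_antisymm
  · rw [codeSpace, direction_affineSpan, vectorSpan_range_eq_span_range_vsub_right ℝ H 0,
      Submodule.span_le]
    rintro _ ⟨i, rfl⟩
    simpa [hcode] using hmem (i + 1) (by omega) (by omega)
  · rw [Submodule.span_le]
    rintro _ ⟨i, -, rfl⟩
    exact codeDiff_mem_codeSpace H i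

theorem linearIndependent_codeDiff (hH : AffineIndependent ℝ H) :
    LinearIndependent ℝ fun i : Set.Icc 1 (n - 1) => codeDiff H i := by
  have hdim : Module.finrank ℝ (codeSpace H) = n - 1 := by
    rw [codeSpace, direction_affineSpan,
      hH.finrank_vectorSpan ((Fintype.card_fin n).trans (Nat.sub_add_cancel NeZero.one_le).symm)]
  rw [linearIndependent_iff_card_eq_finrank_span, Set.finrank, Set.range_comp' (codeDiff H),
    Subtype.range_val, ← codeSpace_eq_span, hdim]
  simp

/-- The vectors `b^1, …, b^(n-1)` of `L(H)` are dual to `c^1, …, c^(n-1)` for the dot product; for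
affinely independent codes they are normals of the spanned hyperplanes. Only the values
of `b` on `[1, n - 1]` matter. -/
structure IsDualFamily (H : Fin n → Fin k → ℝ) (b : ℕ → Fin k → ℝ) : Prop where
  mem_codeSpace : ∀ m ∈ Set.Icc 1 (n - 1), b m ∈ codeSpace H
  dotProduct_codeDiff : ∀ m ∈ Set.Icc 1 (n - 1), ∀ r ∈ Set.Icc 1 (n - 1),
    b m ⬝ᵥ codeDiff H r = if m = r then 1 else 0

theorem exists_isDualFamily (hH : AffineIndependent ℝ H) : ∃ b, IsDualFamily H b := by
  obtain ⟨b, hmem, hdot⟩ := exists_dual_of_linearIndependent (linearIndependent_codeDiff hH)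
  rw [Set.range_comp' (codeDiff H), Subtype.range_val, ← codeSpace_eq_span] at hmem
  refine ⟨fun m => if hm : m ∈ Set.Icc 1 (n - 1) then b ⟨m, hm⟩ else 0, fun m hm => ?_,
    fun m hm r hr => ?_⟩
  · simpa [hm] using hmem ⟨m, hm⟩
  · simpa [hm] using hdot ⟨m, hm⟩ ⟨r, hr⟩

namespace IsDualFamily

variable {b : ℕ → Fin k → ℝ}

theorem dotProduct_eq_zero_of_mem_span (hb : IsDualFamily H b) {m : ℕ}
    (hm : m ∈ Set.Icc 1 (n - 1)) {S : Set ℕ} (hS : S ⊆ Set.Icc 1 (n - 1)) (hmS : m ∉ S)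
    {y : Fin k → ℝ} (hy : y ∈ Submodule.span ℝ (codeDiff H '' S)) : b m ⬝ᵥ y = 0 := by
  have hker : Submodule.span ℝ (codeDiff H '' S) ≤ LinearMap.ker (dotProductBilin ℝ ℝ (b m)) := by
    rw [Submodule.span_le]
    rintro _ ⟨r, hr, rfl⟩
    exact (hb.dotProduct_codeDiff m hm r (hS hr)).trans (if_neg (ne_of_mem_of_not_mem hr hmS).symm)
  exact hker hy

theorem sum_dotProduct_smul_codeDiff (hb : IsDualFamily H b) {y : Fin k → ℝ}
    (hy : y ∈ codeSpace H) :
    ∑ r ∈ Finset.Icc 1 (n - 1), (b r ⬝ᵥ y) • codeDiff H r = y := by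
  let f : (Fin k → ℝ) →ₗ[ℝ] Fin k → ℝ :=
    ∑ r ∈ Finset.Icc 1 (n - 1), (dotProductBilin ℝ ℝ (b r)).smulRight (codeDiff H r)
  have hf : ∀ z, f z = ∑ r ∈ Finset.Icc 1 (n - 1), (b r ⬝ᵥ z) • codeDiff H r := fun z => by
    simp [f]
  have hfc : Set.EqOn f (LinearMap.id (R := ℝ)) (codeDiff H '' Set.Icc 1 (n - 1)) := by
    rintro _ ⟨m, hm, rfl⟩
    rw [hf, Finset.sum_eq_single_of_mem m (Finset.mem_Icc.2 hm) fun r hr hrm => by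
      rw [hb.dotProduct_codeDiff r (Finset.mem_Icc.1 hr) m hm, if_neg hrm, zero_smul],
      hb.dotProduct_codeDiff m hm m hm, if_pos rfl, one_smul, LinearMap.id_apply]
  rw [codeSpace_eq_span] at hy
  exact (hf y).symm.trans (LinearMap.eqOn_span hfc hy)

theorem codeHyperplane_eq_span (hb : IsDualFamily H b) {m : ℕ} (hm : m ∈ Set.Icc 1 (n - 1)) :
    codeHyperplane H (b m) =
      (Submodule.span ℝ (codeDiff H '' (Set.Icc 1 (n - 1) \ {m})) : Set (Fin k → ℝ)) := by
  ext y
  constructor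
  · rintro ⟨hy, hdot⟩
    rw [← hb.sum_dotProduct_smul_codeDiff hy]
    refine Submodule.sum_mem _ fun r hr => ?_
    rcases eq_or_ne r m with rfl | hrm
    · simp [hdot]
    · exact Submodule.smul_mem _ _ (Submodule.subset_span ⟨r, ⟨Finset.mem_Icc.1 hr, hrm⟩, rfl⟩)
  · intro hy
    refine ⟨?_, hb.dotProduct_eq_zero_of_mem_span hm Set.sdiff_subset (by simp) hy⟩
    rw [codeSpace_eq_span]
    exact Submodule.span_mono (Set.image_mono Set.sdiff_subset) hy

theorem isSpannedNormal_smul (hb : IsDualFamily H b) {m : ℕ} (hm : m ∈ Set.Icc 1 (n - 1)) {t : ℝ}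
    (ht : t ≠ 0) : IsSpannedNormal H (t • b m) := by
  refine ⟨Submodule.smul_mem _ t (hb.mem_codeSpace m hm), ?_, _, Set.sdiff_subset (t := {m}), ?_⟩
  · intro hzero
    have hdot := hb.dotProduct_codeDiff m hm m hm
    simp [(smul_eq_zero.1 hzero).resolve_left ht] at hdot
  · rw [← hb.codeHyperplane_eq_span hm]
    simp [codeHyperplane, ht]

theorem exists_eq_smul_of_isSpannedNormal (hb : IsDualFamily H b) {a : Fin k → ℝ}
    (ha : IsSpannedNormal H a) : ∃ m ∈ Set.Icc 1 (n - 1), ∃ t : ℝ, t ≠ 0 ∧ a = t • b m := by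
  obtain ⟨haL, hane, S, hS, hspan⟩ := ha
  have hzero : ∀ y ∈ codeSpace H, (∀ r ∈ Set.Icc 1 (n - 1), y ⬝ᵥ codeDiff H r = 0) → y = 0 :=
    fun y hy hr => eq_zero_of_mem_span_of_dotProduct_eq_zero (codeSpace_eq_span H ▸ hy)
      (Set.forall_mem_image.2 hr)
  obtain ⟨m, hm, ham⟩ : ∃ m ∈ Set.Icc 1 (n - 1), a ⬝ᵥ codeDiff H m ≠ 0 := by
    by_contra! h
    exact hane (hzero a haL h)
  have hmS : m ∉ S := fun h =>
    ham (hspan.ge (Submodule.subset_span (Set.mem_image_of_mem _ h))).2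
  have horth : ∀ r ∈ Set.Icc 1 (n - 1), m ≠ r → a ⬝ᵥ codeDiff H r = 0 := by
    intro r hr hmr
    have hw : (a ⬝ᵥ codeDiff H r) • codeDiff H m - (a ⬝ᵥ codeDiff H m) • codeDiff H r ∈
        codeHyperplane H a :=
      ⟨sub_mem (Submodule.smul_mem _ _ (codeDiff_mem_codeSpace H m))
        (Submodule.smul_mem _ _ (codeDiff_mem_codeSpace H r)), by
        simp only [dotProduct_sub, dotProduct_smul, smul_eq_mul]; ring⟩
    simpa [dotProduct_sub, dotProduct_smul, hb.dotProduct_codeDiff m hm, hm, hr, hmr] using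
      hb.dotProduct_eq_zero_of_mem_span hm hS hmS (hspan.le hw)
  refine ⟨m, hm, _, ham, sub_eq_zero.1 (hzero _
    (sub_mem haL (Submodule.smul_mem _ _ (hb.mem_codeSpace m hm))) fun r hr => ?_)⟩
  rcases eq_or_ne m r with rfl | hmr
  · simp [sub_dotProduct, hb.dotProduct_codeDiff m hm m hm]
  · simp [sub_dotProduct, hb.dotProduct_codeDiff m hm r hr, horth r hr hmr, hmr]

end IsDualFamily

/-- The solution set of the lower general inequality with normal `b`. That of the upper one is
`lowerHalfspace H (-b)`. -/
def lowerHalfspace (H : Fin n → Fin k → ℝ) (b : Fin k → ℝ) :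
    Set ((Fin (n + 1) → ℝ) × (Fin k → ℝ)) :=
  {p | ∑ j : Fin (n + 1), min (b ⬝ᵥ code H ((j : ℕ) + 1)) (b ⬝ᵥ code H (j : ℕ)) * p.1 j ≤ b ⬝ᵥ p.2}

theorem lowerHalfspace_neg (H : Fin n → Fin k → ℝ) (b : Fin k → ℝ) :
    lowerHalfspace H (-b) = {p | b ⬝ᵥ p.2 ≤
      ∑ j : Fin (n + 1), max (b ⬝ᵥ code H ((j : ℕ) + 1)) (b ⬝ᵥ code H (j : ℕ)) * p.1 j} := by
  simp only [lowerHalfspace, neg_dotProduct, min_neg_neg, neg_mul, Finset.sum_neg_distrib,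
    neg_le_neg_iff]

theorem lowerHalfspace_smul (H : Fin n → Fin k → ℝ) (b : Fin k → ℝ) {t : ℝ} (ht : 0 < t) :
    lowerHalfspace H (t • b) = lowerHalfspace H b := by
  simp only [lowerHalfspace, smul_dotProduct, smul_eq_mul, ← mul_min_of_nonneg _ _ ht.le, mul_assoc,
    ← Finset.mul_sum, mul_le_mul_iff_right₀ ht]

theorem zero_mk_mem_lowerHalfspace {b y : Fin k → ℝ} :
    ((0, y) : (Fin (n + 1) → ℝ) × (Fin k → ℝ)) ∈ lowerHalfspace H b ↔ 0 ≤ b ⬝ᵥ y := by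
  simp [lowerHalfspace]

theorem IsSpannedNormal.neg {b : Fin k → ℝ} (hb : IsSpannedNormal H b) :
    IsSpannedNormal H (-b) := by
  obtain ⟨hL, hne, S, hS, hspan⟩ := hb
  refine ⟨neg_mem hL, neg_ne_zero.2 hne, S, hS, ?_⟩
  rw [← hspan]
  simp [codeHyperplane]

theorem generalInequalities_eq_image (H : Fin n → Fin k → ℝ) :
    generalInequalities H = lowerHalfspace H '' {b | IsSpannedNormal H b} := by
  ext W
  constructor
  · rintro ⟨b, hb, rfl | rfl⟩
    · exact ⟨b, hb, rfl⟩
    · exact ⟨-b, hb.neg, lowerHalfspace_neg H b⟩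
  · rintro ⟨b, hb, rfl⟩
    exact ⟨b, hb, .inl rfl⟩

namespace IsDualFamily

variable {b : ℕ → Fin k → ℝ}

theorem generalInequalities_eq (hb : IsDualFamily H b) :
    generalInequalities H =
      (fun p : ℕ × ℝ => lowerHalfspace H (p.2 • b p.1)) '' (Set.Icc 1 (n - 1) ×ˢ {1, -1}) := by
  rw [generalInequalities_eq_image]
  apply Set.Subset.antisymm
  · rintro _ ⟨a, ha, rfl⟩
    obtain ⟨m, hm, t, ht, rfl⟩ := hb.exists_eq_smul_of_isSpannedNormal ha
    rcases ht.lt_or_gt with hneg | hpos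
    · refine ⟨(m, -1), ⟨hm, by simp⟩, ?_⟩
      simpa using (lowerHalfspace_smul H (-b m) (neg_pos.2 hneg)).symm
    · refine ⟨(m, 1), ⟨hm, by simp⟩, ?_⟩
      simpa using (lowerHalfspace_smul H (b m) hpos).symm
  · rintro _ ⟨⟨m, σ⟩, ⟨hm, hσ⟩, rfl⟩
    exact ⟨_, hb.isSpannedNormal_smul hm (by rintro rfl; simp at hσ), rfl⟩

theorem injOn_lowerHalfspace (hb : IsDualFamily H b) :
    Set.InjOn (fun p : ℕ × ℝ => lowerHalfspace H (p.2 • b p.1))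
      (Set.Icc 1 (n - 1) ×ˢ {1, -1}) := by
  rintro ⟨m, σ⟩ ⟨hm, hσ⟩ ⟨m', σ'⟩ ⟨hm', hσ'⟩ heq
  have hiff := Set.ext_iff.1 heq (0, -σ • codeDiff H m)
  simp only [zero_mk_mem_lowerHalfspace, smul_dotProduct, dotProduct_smul, smul_eq_mul,
    hb.dotProduct_codeDiff m hm m hm, hb.dotProduct_codeDiff m' hm' m hm] at hiff
  rcases hσ with rfl | rfl <;> rcases hσ' with rfl | rfl <;> grind

end IsDualFamily

theorem sizeG_of_affineIndependent (hH : AffineIndependent ℝ H) : sizeG H = 2 * (n - 1) := by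
  obtain ⟨b, hb⟩ := exists_isDualFamily hH
  rw [sizeG, hb.generalInequalities_eq, hb.injOn_lowerHalfspace.ncard_image,
    Set.ncard_prod, Set.ncard_pair (by norm_num), Set.ncard_eq_toFinset_card', Set.toFinset_Icc,
    Nat.card_Icc, Nat.add_sub_cancel, mul_comm]

theorem boundIndices_of_affineIndependent (hH : AffineIndependent ℝ H) :
    boundIndices H = {1, n + 1} := by
  obtain ⟨b, hb⟩ := exists_isDualFamily hH
  refine Set.union_eq_self_of_subset_right ?_
  rintro j ⟨⟨hj, hjn⟩, hspan⟩
  have hm : j - 1 ∈ Set.Icc 1 (n - 1) := ⟨by omega, by omega⟩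
  have hone := hb.dotProduct_codeDiff _ hm _ hm
  rw [hb.dotProduct_eq_zero_of_mem_span hm Set.sdiff_subset (by simp)
    (hspan ▸ codeDiff_mem_codeSpace H (j - 1))] at hone
  simp at hone

theorem sizeB_of_affineIndependent (hH : AffineIndependent ℝ H) : sizeB H = 2 := by
  have hbound : boundInequalities H =
      (fun j : Fin (n + 1) => {p | 0 ≤ p.1 j}) '' {0, Fin.last n} := by
    refine Set.ext fun W => exists_congr fun j => and_congr ?_ eq_comm
    simp only [boundIndices_of_affineIndependent hH, Set.mem_insert_iff, Set.mem_singleton_iff,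
      Fin.ext_iff, Fin.val_zero, Fin.val_last]
    omega
  rw [sizeB, hbound, Set.ncard_image_of_injective _ injective_setOf_nonneg_fst_apply,
    Set.ncard_pair Fin.last_pos'.ne]

end Sizes

theorem affineIndependent_unaryEncoding (n : ℕ) : AffineIndependent ℝ (unaryEncoding n) := by
  have hbasis : unaryEncoding n = Pi.basisFun ℝ (Fin n) :=
    funext fun i => (Pi.basisFun_apply ℝ (Fin n) i).symm
  exact hbasis ▸ (Pi.basisFun ℝ (Fin n)).linearIndependent.affineIndependent

theorem corollary2 (n : ℕ) [NeZero n] :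
    (∀ (lam : Fin (n + 1) → ℝ) (y : Fin n → ℝ),
      (lam, y) ∈ embeddingHull (sos2 n) (unaryEncoding n) ↔
        (∑ j, lam j = 1 ∧ ∑ i, y i = 1) ∧
        (∀ l ∈ Finset.Icc 1 (n - 1),
          (∑ j : Fin (n + 1) with l + 2 ≤ j.val + 1, lam j
              ≤ ∑ i : Fin n with l + 1 ≤ i.val + 1, y i) ∧
          (∑ j : Fin (n + 1) with j.val + 1 ≤ l, lam j
              ≤ ∑ i : Fin n with i.val + 1 ≤ l, y i)) ∧
        0 ≤ lam 0 ∧ 0 ≤ lam (Fin.last n)) ∧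
    (∀ l ∈ Finset.Icc 1 (n - 1),
      IsFacetDefining (embeddingHull (sos2 n) (unaryEncoding n))
        ((∑ j : Fin (n + 1) with l + 2 ≤ j.val + 1, lamCoord j)
          - (∑ i : Fin n with l + 1 ≤ i.val + 1, yCoord i)) 0 ∧
      IsFacetDefining (embeddingHull (sos2 n) (unaryEncoding n))
        ((∑ j : Fin (n + 1) with j.val + 1 ≤ l, lamCoord j)
          - (∑ i : Fin n with i.val + 1 ≤ l, yCoord i)) 0) ∧
    IsFacetDefining (embeddingHull (sos2 n) (unaryEncoding n)) (-lamCoord 0) 0 ∧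
    IsFacetDefining (embeddingHull (sos2 n) (unaryEncoding n)) (-lamCoord (Fin.last n)) 0 ∧
    polySize (embeddingHull (sos2 n) (unaryEncoding n)) = 2 * n + 4 ∧
    sizeG (unaryEncoding n) = 2 * (n - 1) ∧
    sizeB (unaryEncoding n) = 2 := by
  refine ⟨fun lam y => ?_, fun l hl => ?_, isFacetDefining_neg_lamCoord_zero,
    isFacetDefining_neg_lamCoord_last, polySize_embeddingHull_sos2_unaryEncoding,
    sizeG_of_affineIndependent (affineIndependent_unaryEncoding n),
    sizeB_of_affineIndependent (affineIndependent_unaryEncoding n)⟩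
  · rw [embeddingHull_sos2_unaryEncoding]
    exact and_congr_right fun hsum =>
      forall_interlacingGap_nonneg_iff (hsum.1.trans hsum.2.symm)
  · obtain ⟨hl, hln⟩ := Finset.mem_Icc.1 hl
    obtain ⟨l, rfl⟩ := Nat.exists_eq_add_of_le' hl
    exact ⟨isFacetDefining_sum_tail ⟨l + 1, by omega⟩, isFacetDefining_sum_head ⟨l, by omega⟩⟩
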